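/- Let $d \ge 2$, $k \ge 1$ and $r \ge 0$ be integers with $(k,r) \ne (1,1)$, let $n = (r+1)(k-1)d+1$, and let $F_1, \ldots, F_n$ be finite subsets of $\mathbb{R}^d$ (the colour classes) with exactly $k$ points each. A point is regarded together with its colour, so the classes may overlap as subsets of $\mathbb{R}^d$. Then the coloured points can be partitioned into $k$ colourful sets $A_1, \ldots, A_k$, that is, one can choose points $x^i_j \in F_j$ ($1 \le i \le k$, $1 \le j \le n$) such that for each $j$ the points $x^1_j, \ldots, x^k_j$ are pairwise distinct, where $A_i$ consists of $x^i_1, \ldots, x^i_n$ with $x^i_j$ of colour $j$, with the following property. For every set $C \subseteq \{1, \ldots, n\}$ of exactly $r$ colours, the convex hulls of the sets $A_i \setminus C = \{x^i_j : j \notin C\}$ intersect with equal coefficients: there are real numbers $\alpha_j \ge 0$ ($j \notin C$) with $\sum_{j \notin C} \alpha_j = 1$ such that the point $\sum_{j \notin C} \alpha_j x^i_j$ is the same for all $i = 1, \ldots, k$. -/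

import Mathlib

open scoped BigOperators

/-- A colourful `k`-partition of the colour classes `F 0, …, F (n-1)` in `ℝ^d`, listed as
`A_i = {x i j : j}`, where `x i j` is the element of colour `j` in the `i`-th part: every part takes
exactly one point from every colour class, and distinct parts take distinct points of each class.
Points are regarded together with their colour, so the classes need not be disjoint as subsets
of `ℝ^d`. -/
structure IsColourfulPartition {d n k : ℕ} (F : Fin n → Finset (EuclideanSpace ℝ (Fin d)))
    (x : Fin k → Fin n → EuclideanSpace ℝ (Fin d)) : Prop where
  mem : ∀ i j, x i j ∈ F j
  disjoint : ∀ i i', i ≠ i' → ∀ j, x i j ≠ x i' j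

/-- The convex hulls of the sets `{x i j : j ∈ J}` (the parts restricted to the colours in `J`)
intersect with equal coefficients: one convex combination, indexed by the colours in `J`, yields
the same point `q` in every part. -/
def IntersectWithEqualCoefficients {d n k : ℕ}
    (x : Fin k → Fin n → EuclideanSpace ℝ (Fin d)) (J : Finset (Fin n)) : Prop :=
  ∃ α : Fin n → ℝ, (∀ j ∈ J, 0 ≤ α j) ∧ ∑ j ∈ J, α j = 1 ∧
    ∃ q : EuclideanSpace ℝ (Fin d), ∀ i, ∑ j ∈ J, α j • x i j = q

/-! Centre each class at its mean and list it as one vector of (ℝ^d)^k with entries summing to zero,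
a space of dimension p = (k-1)d. Cyclic shifts of a vector sum to zero, and equal coefficients
amount to 0 being a convex combination of chosen shifts. The core is a colourful Carathéodory
argument by induction on tolerance (`exists_orbit_choice_zero_mem_convexHull`). A failing choice and
deletion nearest to 0 has its nearest point P carried by p indices. Give the other ps+1 a tolerant
choice and rotate it by all k ≤ p shifts: the failing deletions, each of size at most s, must cover
them, which is too many. -/

theorem norm_sq_le_inner_of_norm_le_infDist {W : Type*} [NormedAddCommGroup W]
    [InnerProductSpace ℝ W] {K : Set W} (hK : Convex ℝ K) {P : W} (hP : P ∈ K)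
    (hmin : ‖P‖ ≤ Metric.infDist 0 K) {x : W} (hx : x ∈ K) : ‖P‖ ^ 2 ≤ inner ℝ P x := by
  have key : ‖(0 : W) - P‖ = ⨅ w : K, ‖(0 : W) - w‖ := by
    have : Nonempty K := ⟨⟨P, hP⟩⟩
    apply le_antisymm
    · refine le_ciInf fun w => ?_
      have := Metric.infDist_le_dist_of_mem (x := (0 : W)) w.2
      rw [dist_eq_norm] at this
      simpa using hmin.trans (by simpa using this)
    · exact ciInf_le (f := fun w : K => ‖(0 : W) - w‖)
        ⟨0, by rintro _ ⟨w, rfl⟩; positivity⟩ ⟨P, hP⟩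
  have h := (norm_eq_iInf_iff_real_inner_le_zero hK hP).1 key x hx
  rw [zero_sub, inner_neg_left, inner_sub_right, real_inner_self_eq_norm_sq] at h
  linarith

/-- The point of a convex hull nearest to the origin, if it is not the origin, is a convex
combination of at most as many points as the dimension of the span. -/
theorem exists_finset_card_le_of_nearest {W ι : Type*} [NormedAddCommGroup W]
    [InnerProductSpace ℝ W] [FiniteDimensional ℝ W] (U : Submodule ℝ W)
    (f : ι → W) (hf : ∀ i, f i ∈ U) {J : Finset ι} {P : W} (hP0 : P ≠ 0)
    (hP : P ∈ convexHull ℝ (f '' (J : Set ι)))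
    (hmin : ∀ x ∈ convexHull ℝ (f '' (J : Set ι)), ‖P‖ ^ 2 ≤ inner ℝ P x) :
    ∃ I ⊆ J, I.card ≤ Module.finrank ℝ U ∧ P ∈ convexHull ℝ (f '' (I : Set ι)) := by
  classical
  obtain ⟨κ, _, z, w, hz, hind, hw, hw1, hsum⟩ := eq_pos_convex_span_of_mem_convexHull hP
  have hz' : ∀ c, ∃ i ∈ J, f i = z c := fun c => by
    obtain ⟨i, hi, h⟩ := hz ⟨c, rfl⟩
    exact ⟨i, hi, h⟩
  choose e heJ he using hz'
  have hge : ∀ c, ‖P‖ ^ 2 ≤ inner ℝ P (z c) := fun c =>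
    hmin _ (subset_convexHull ℝ _ (hz ⟨c, rfl⟩))
  have hPpos : 0 < ‖P‖ ^ 2 := by positivity
  have heq : ∀ c, inner ℝ P (z c) = ‖P‖ ^ 2 := by
    have h0 : ∑ c, w c * (inner ℝ P (z c) - ‖P‖ ^ 2) = 0 := by
      have h1 : ∑ c, w c * inner ℝ P (z c) = ‖P‖ ^ 2 := by
        rw [← real_inner_self_eq_norm_sq]
        nth_rw 3 [← hsum]
        simp [inner_sum, inner_smul_right]
      simp_rw [mul_sub, Finset.sum_sub_distrib, ← Finset.sum_mul, h1, hw1]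
      ring
    intro c
    have := (Finset.sum_eq_zero_iff_of_nonneg
      (fun c _ => mul_nonneg (hw c).le (sub_nonneg.2 (hge c)))).1 h0 c (Finset.mem_univ c)
    rcases mul_eq_zero.1 this with h | h
    · exact absurd h (hw c).ne'
    · linarith
  -- The points lie on a hyperplane missing 0, so affine independence becomes linear; this saves one
  -- point over Carathéodory.
  have hlin : LinearIndependent ℝ z := by
    rw [Fintype.linearIndependent_iff]
    intro v hv c
    have hv0 : ∑ c, v c = 0 := by
      have : inner ℝ P (∑ c, v c • z c) = 0 := by rw [hv, inner_zero_right]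
      simp only [inner_sum, inner_smul_right, heq, ← Finset.sum_mul] at this
      exact (mul_eq_zero.1 this).resolve_right hPpos.ne'
    exact (affineIndependent_iff.1 hind) Finset.univ v hv0 hv c (Finset.mem_univ c)
  have hzU : ∀ c, z c ∈ U := fun c => he c ▸ hf _
  have hlinU : LinearIndependent ℝ (fun c => (⟨z c, hzU c⟩ : U)) :=
    LinearIndependent.of_comp U.subtype hlin
  refine ⟨Finset.univ.image e, ?_, ?_, ?_⟩
  · intro i hi
    obtain ⟨c, -, rfl⟩ := Finset.mem_image.1 hi
    exact heJ c
  · exact Finset.card_image_le.trans hlinU.fintype_card_le_finrank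
  · refine mem_convexHull_of_exists_fintype w z (fun c => (hw c).le) hw1 (fun c => ?_) hsum
    exact ⟨e c, by simp, he c⟩

/-- A tolerant colourful Carathéodory theorem for the orbits of a finite group acting linearly
without nonzero invariants. -/
theorem exists_orbit_choice_zero_mem_convexHull {W ι G : Type*} [NormedAddCommGroup W]
    [InnerProductSpace ℝ W] [FiniteDimensional ℝ W] [Fintype ι] [DecidableEq ι]
    [AddGroup G] [Fintype G] (T : G → W →ₗ[ℝ] W) (hT : ∀ g h v, T (g + h) v = T g (T h v))
    (U : Submodule ℝ W) {p : ℕ} (hp : Module.finrank ℝ U ≤ p) (hG : Fintype.card G ≤ p)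
    (a : ι → W) (haU : ∀ g i, T g (a i) ∈ U) (ha : ∀ i, ∑ g, T g (a i) = 0) (s : ℕ) :
    ∀ J : Finset ι, J.card = p * s + 1 → ∃ g : ι → G, ∀ C : Finset ι, C.card < s →
      (0 : W) ∈ convexHull ℝ ((fun i => T (g i) (a i)) '' ((J \ C : Finset ι) : Set ι)) := by
  classical
  induction s with
  | zero => exact fun _ _ => ⟨fun _ => 0, fun C hC => absurd hC (Nat.not_lt_zero _)⟩
  | succ s ih =>
    intro J hJ
    by_contra! hcon
    have hp1 : 1 ≤ p := (Fintype.card_pos (α := G)).trans_le hG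
    let K : (ι → G) × Finset ι → Set W := fun q =>
      convexHull ℝ ((fun i => T (q.1 i) (a i)) '' ((J \ q.2 : Finset ι) : Set ι))
    let B : Finset ((ι → G) × Finset ι) :=
      Finset.univ.filter fun q => q.2.card < s + 1 ∧ (0 : W) ∉ K q
    have hB : B.Nonempty := by
      obtain ⟨C, hC, h0⟩ := hcon fun _ => 0
      exact ⟨(fun _ => 0, C), Finset.mem_filter.2 ⟨Finset.mem_univ _, hC, h0⟩⟩
    obtain ⟨⟨g₀, C₀⟩, hq₀, hqmin⟩ := Finset.exists_min_image B (fun q => Metric.infDist 0 (K q)) hB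
    obtain ⟨hC₀, h0⟩ := (Finset.mem_filter.1 hq₀).2
    have hKne : (K (g₀, C₀)).Nonempty := by
      have : (J \ C₀).Nonempty := by
        rw [← Finset.card_pos]
        have h1 := Finset.le_card_sdiff C₀ J
        have h2 : s + 1 ≤ p * (s + 1) := Nat.le_mul_of_pos_left _ hp1
        simp only at hC₀
        omega
      exact (this.to_set.image _).convexHull
    have hKc : IsCompact (K (g₀, C₀)) :=
      (((J \ C₀).finite_toSet.image _)).isCompact_convexHull ℝ
    obtain ⟨P, hPK, hPd⟩ := hKc.exists_infDist_eq_dist hKne 0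
    have hPn : Metric.infDist 0 (K (g₀, C₀)) = ‖P‖ := by rw [hPd, dist_eq_norm, zero_sub, norm_neg]
    have hP0 : P ≠ 0 := fun h => h0 (h ▸ hPK)
    have hPpos : 0 < ‖P‖ ^ 2 := by positivity
    obtain ⟨I, hIJ, hIcard, hPI⟩ := exists_finset_card_le_of_nearest U
      (fun i => T (g₀ i) (a i)) (fun i => haU _ _) hP0 hPK
      (fun x hx => norm_sq_le_inner_of_norm_le_infDist (convex_convexHull ℝ _) hPK hPn.ge hx)
    obtain ⟨I', hII', hI'J, hI'card⟩ := Finset.exists_subsuperset_card_eq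
      (hIJ.trans Finset.sdiff_subset) (hIcard.trans hp)
      (by rw [hJ]; nlinarith [Nat.zero_le (p * s)])
    have hM : (J \ I').card = p * s + 1 := by
      rw [Finset.card_sdiff_of_subset hI'J, hJ, hI'card, Nat.mul_succ]
      omega
    obtain ⟨m, hm⟩ := ih (J \ I') hM
    let γ : G → ι → G := fun h i => if i ∈ J \ I' then h + m i else g₀ i
    choose D hDcard hD0 using fun h => hcon (γ h)
    -- Otherwise fewer than `s` of the inductive indices are deleted, and `T h` carries their hull,
    -- with 0 in it, into the failing one.
    have hDM : ∀ h, D h ⊆ J \ I' := by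
      intro h
      by_contra hsub
      have hlt : (D h ∩ (J \ I')).card < s := by
        have : D h ∩ (J \ I') ⊂ D h :=
          Finset.inter_subset_left.ssubset_of_ne fun he => hsub (Finset.inter_eq_left.1 he)
        have := Finset.card_lt_card this
        have := hDcard h
        omega
      apply hD0 h
      have h1 := Set.mem_image_of_mem (T h) (hm _ hlt)
      rw [map_zero, LinearMap.image_convexHull, Set.image_image] at h1
      refine convexHull_mono ?_ h1
      rintro _ ⟨i, hi, rfl⟩
      simp only [Finset.coe_sdiff, Set.mem_sdiff, Finset.mem_coe, Finset.mem_inter,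
        Finset.mem_sdiff, not_and] at hi
      refine ⟨i, ?_, ?_⟩
      · simp only [Finset.coe_sdiff, Set.mem_sdiff, Finset.mem_coe]
        exact ⟨hi.1.1, fun hd => hi.2 hd hi.1.1 hi.1.2⟩
      · have : i ∈ J \ I' := Finset.mem_sdiff.2 hi.1
        simp only [γ, if_pos this, hT]
    have hPD : ∀ h, P ∈ K (γ h, D h) := by
      intro h
      refine convexHull_mono ?_ hPI
      rintro _ ⟨i, hi, rfl⟩
      have hiM : i ∉ J \ I' := fun hi' => (Finset.mem_sdiff.1 hi').2 (hII' hi)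
      refine ⟨i, ?_, by simp only [γ, if_neg hiM]⟩
      exact Finset.mem_coe.2 (Finset.mem_sdiff.2 ⟨hI'J (hII' hi), fun hd => hiM (hDM h hd)⟩)
    -- `P` survives in each failing hull, so by minimality it is nearest to 0 there too.
    have hhalf : ∀ h, ∀ i ∈ J \ I', i ∉ D h → 0 < inner ℝ P (T (h + m i) (a i)) := by
      intro h i hi hid
      have hle : ‖P‖ ≤ Metric.infDist 0 (K (γ h, D h)) := by
        rw [← hPn]
        exact hqmin (γ h, D h) (Finset.mem_filter.2 ⟨Finset.mem_univ _, hDcard h, hD0 h⟩)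
      refine hPpos.trans_le (norm_sq_le_inner_of_norm_le_infDist (convex_convexHull ℝ _)
        (hPD h) hle (subset_convexHull ℝ _ ⟨i, ?_, by simp only [γ, if_pos hi]⟩))
      exact Finset.mem_coe.2 (Finset.mem_sdiff.2 ⟨(Finset.mem_sdiff.1 hi).1, hid⟩)
    -- A whole orbit sums to zero, so it cannot lie in an open half-space.
    have hcover : J \ I' ⊆ Finset.univ.biUnion D := by
      intro i hi
      by_contra hnot
      simp only [Finset.mem_biUnion, Finset.mem_univ, true_and, not_exists] at hnot
      have hpos : 0 < ∑ h, inner ℝ P (T (h + m i) (a i)) :=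
        Finset.sum_pos (fun h _ => hhalf h i hi (hnot h)) Finset.univ_nonempty
      have hzero : ∑ h, T (h + m i) (a i) = 0 :=
        (Equiv.sum_comp (Equiv.addRight (m i)) fun h => T h (a i)).trans (ha i)
      rw [← inner_sum, hzero, inner_zero_right] at hpos
      exact lt_irrefl _ hpos
    have hcount : p * s + 1 ≤ p * s :=
      calc p * s + 1 = (J \ I').card := hM.symm
        _ ≤ (Finset.univ.biUnion D).card := Finset.card_le_card hcover
        _ ≤ Fintype.card G * s :=
          Finset.card_biUnion_le_card_mul _ _ _ fun h _ => Nat.lt_succ_iff.1 (hDcard h)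
        _ ≤ p * s := Nat.mul_le_mul_right _ hG
    omega

theorem exists_weights_of_mem_convexHull_image {W ι : Type*} [AddCommGroup W] [Module ℝ W]
    {f : ι → W} {J : Finset ι} {x : W} (hx : x ∈ convexHull ℝ (f '' (J : Set ι))) :
    ∃ α : ι → ℝ, (∀ j, 0 ≤ α j) ∧ ∑ j ∈ J, α j = 1 ∧ ∑ j ∈ J, α j • f j = x := by
  classical
  obtain ⟨κ, _, w, z, hw, hw1, hz, hsum⟩ := mem_convexHull_iff_exists_fintype.1 hx
  choose e heJ he using hz
  refine ⟨fun j => ∑ c with e c = j, w c, fun j => Finset.sum_nonneg fun c _ => hw c, ?_, ?_⟩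
  · rw [Finset.sum_fiberwise_of_maps_to (fun c _ => heJ c), hw1]
  · rw [← hsum, ← Finset.sum_fiberwise_of_maps_to (s := Finset.univ) (t := J)
      (g := e) (fun c _ => heJ c)]
    refine Finset.sum_congr rfl fun j _ => ?_
    rw [Finset.sum_smul]
    refine Finset.sum_congr rfl fun c hc => ?_
    rw [← (Finset.mem_filter.1 hc).2, he]

/-- The linear action of the cyclic group on `k`-tuples by shifting the indices. -/
noncomputable def cyclicShift (k : ℕ) [NeZero k] (E : Type*) [NormedAddCommGroup E]
    [InnerProductSpace ℝ E] (g : Fin k) :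
    PiLp 2 (fun _ : Fin k => E) →ₗ[ℝ] PiLp 2 (fun _ : Fin k => E) where
  toFun v := WithLp.toLp 2 fun i => v (i + g)
  map_add' _ _ := rfl
  map_smul' _ _ := rfl

theorem cyclicShift_apply (k : ℕ) [NeZero k] (E : Type*) [NormedAddCommGroup E]
    [InnerProductSpace ℝ E] (g : Fin k) (v : PiLp 2 (fun _ : Fin k => E)) (i : Fin k) :
    cyclicShift k E g v i = v (i + g) := rfl

/-- The sum of the entries of a `k`-tuple, as a linear map. -/
noncomputable def tupleSum (k : ℕ) (E : Type*) [NormedAddCommGroup E] [InnerProductSpace ℝ E] :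
    PiLp 2 (fun _ : Fin k => E) →ₗ[ℝ] E where
  toFun v := ∑ i, v i
  map_add' v w := by simp [Finset.sum_add_distrib]
  map_smul' c v := by simp [Finset.smul_sum]

theorem finrank_ker_tupleSum (k : ℕ) [NeZero k] (E : Type*) [NormedAddCommGroup E]
    [InnerProductSpace ℝ E] [FiniteDimensional ℝ E] :
    Module.finrank ℝ (LinearMap.ker (tupleSum k E)) = (k - 1) * Module.finrank ℝ E := by
  classical
  have hsurj : LinearMap.range (tupleSum k E) = ⊤ := by
    rw [LinearMap.range_eq_top]
    intro x
    exact ⟨WithLp.toLp 2 (Pi.single 0 x), by simp [tupleSum]⟩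
  have h := LinearMap.finrank_range_add_finrank_ker (tupleSum k E)
  rw [hsurj, finrank_top, (WithLp.linearEquiv 2 ℝ (Fin k → E)).finrank_eq,
    Module.finrank_pi_fintype] at h
  simp only [Finset.sum_const, Finset.card_univ, Fintype.card_fin, smul_eq_mul] at h
  rw [Nat.sub_mul, one_mul]
  omega

/-- With at least two parts, a partition with tolerance `r` exists among those obtained from one
enumeration of the colour classes by cyclic shifts. -/
theorem exists_colourfulPartition_of_two_le (d k r n : ℕ) (hd : 2 ≤ d) (hk : 2 ≤ k)
    (hn : n = (r + 1) * (k - 1) * d + 1)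
    (F : Fin n → Finset (EuclideanSpace ℝ (Fin d))) (hF : ∀ j, (F j).card = k) :
    ∃ x : Fin k → Fin n → EuclideanSpace ℝ (Fin d),
      IsColourfulPartition F x ∧
        ∀ C : Finset (Fin n), C.card = r →
          IntersectWithEqualCoefficients x (Finset.univ \ C) := by
  classical
  have : NeZero k := ⟨by omega⟩
  let E := EuclideanSpace ℝ (Fin d)
  let e : ∀ j, Fin k ≃ F j := fun j => ((F j).equivFinOfCardEq (hF j)).symm
  let mean : Fin n → E := fun j => (k : ℝ)⁻¹ • ∑ i, (e j i : E)
  let a : Fin n → PiLp 2 (fun _ : Fin k => E) := fun j =>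
    WithLp.toLp 2 fun i => (e j i : E) - mean j
  have hsum : ∀ j, ∑ i, a j i = 0 := by
    intro j
    have hk0 : (k : ℝ) ≠ 0 := Nat.cast_ne_zero.2 (NeZero.ne k)
    simp only [a, Finset.sum_sub_distrib, Finset.sum_const, Finset.card_univ, Fintype.card_fin]
    rw [← Nat.cast_smul_eq_nsmul ℝ, smul_smul, mul_inv_cancel₀ hk0, one_smul, sub_self]
  obtain ⟨g, hg⟩ := exists_orbit_choice_zero_mem_convexHull (cyclicShift k E)
    (fun g h v => by
      ext1 i
      simp only [cyclicShift_apply, add_assoc])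
    (LinearMap.ker (tupleSum k E)) (p := (k - 1) * d)
    (by rw [finrank_ker_tupleSum]; simp [E])
    -- `k ≤ (k - 1) * d` needs both `d ≥ 2` and `k ≥ 2`.
    (by
      rw [Fintype.card_fin]
      obtain ⟨l, rfl⟩ : ∃ l, k = l + 2 := ⟨k - 2, by omega⟩
      rw [show l + 2 - 1 = l + 1 by omega]
      nlinarith)
    a
    (fun g j => by
      rw [LinearMap.mem_ker]
      change ∑ i, a j (i + g) = 0
      exact (Equiv.sum_comp (Equiv.addRight g) fun i => a j i).trans (hsum j))
    (fun j => by
      ext1 i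
      rw [WithLp.ofLp_sum, Finset.sum_apply]
      change ∑ g, a j (i + g) = 0
      exact (Equiv.sum_comp (Equiv.addLeft i) fun i => a j i).trans (hsum j))
    (r + 1) Finset.univ (by rw [Finset.card_univ, Fintype.card_fin, hn]; ring)
  refine ⟨fun i j => e j (i + g j), ⟨fun i j => (e j _).2, fun i i' hii' j h => hii' ?_⟩, ?_⟩
  · exact add_right_cancel ((e j).injective (Subtype.ext h))
  · intro C hC
    obtain ⟨α, hα, hα1, hα0⟩ := exists_weights_of_mem_convexHull_image (hg C (by omega))
    refine ⟨α, fun j _ => hα j, hα1, ∑ j ∈ Finset.univ \ C, α j • mean j, fun i => ?_⟩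
    have hi := congrArg (fun v : PiLp 2 (fun _ : Fin k => E) => v i) hα0
    simp only [WithLp.ofLp_sum, Finset.sum_apply, PiLp.smul_apply, cyclicShift_apply,
      PiLp.zero_apply, a, smul_sub, Finset.sum_sub_distrib] at hi
    exact sub_eq_zero.1 hi

theorem theorem2 (d k r n : ℕ) (hd : 2 ≤ d) (hk : 1 ≤ k) (hkr : ¬ (k = 1 ∧ r = 1))
    (hn : n = (r + 1) * (k - 1) * d + 1)
    (F : Fin n → Finset (EuclideanSpace ℝ (Fin d))) (hF : ∀ j, (F j).card = k) :
    ∃ x : Fin k → Fin n → EuclideanSpace ℝ (Fin d),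
      IsColourfulPartition F x ∧
        ∀ C : Finset (Fin n), C.card = r →
          IntersectWithEqualCoefficients x (Finset.univ \ C) := by
  rcases hk.eq_or_lt with rfl | hk2
  · obtain rfl : n = 1 := by simpa using hn
    have hne : ∀ j, (F j).Nonempty := fun j => Finset.card_pos.1 (by rw [hF j]; exact one_pos)
    choose y hy using hne
    refine ⟨fun _ j => y j, ⟨fun _ j => hy j, fun i i' h => absurd (Subsingleton.elim i i') h⟩,
      fun C hC => ?_⟩
    -- With a single colour, `r ≥ 2` is vacuous and `r = 1` is excluded.
    have hC1 : C.card ≤ 1 := by simpa using C.card_le_univ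
    have hr : r = 0 := by omega
    obtain rfl : C = ∅ := Finset.card_eq_zero.1 (hC.trans hr)
    exact ⟨fun _ => 1, fun _ _ => zero_le_one, by simp, y 0, by simp⟩
  · exact exists_colourfulPartition_of_two_le d k r n hd hk2 hn F hF
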